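/- For an integer $n \ge 3$, let $J_n$ (the flower snark) be the graph on the $4n$ vertices $a^i, b^i, c^i, d^i$ ($1 \le i \le n$) in which $a^i$ is adjacent to $b^i$, $c^i$ and $d^i$ for every $i$, the vertices $b^1, b^2, \dots, b^n$ form an $n$-cycle in this order, the vertices $c^1, \dots, c^n, d^1, \dots, d^n$ form a $2n$-cycle in this order, and there are no other edges. For a finite simple graph $G = (V, E)$, a set $S \subseteq V$ is a dominating set if every vertex outside $S$ is adjacent to a vertex of $S$. A dominating set $S$ is a secure dominating set if for every $v \in V \setminus S$ there is $w \in S$ with $vw \in E$ such that $(S \setminus \{w\}) \cup \{v\}$ is a dominating set. The secure domination number $\gamma_s(G)$ is the minimum size of a secure dominating set of $G$. For $f : V \to \{0,1,2\}$, a vertex $v$ is undefended with respect to $f$ if $f(v) = 0$ and $f(w) = 0$ for every vertex $w$ adjacent to $v$. The function $f$ is a weak Roman dominating function on $G$ if for every vertex $v$ with $f(v) = 0$ there is a vertex $w$ adjacent to $v$ with $f(w) \ge 1$ such that no vertex is undefended with respect to the function $g : V \to \{0,1,2\}$ given by $g(v) = 1$, $g(w) = f(w) - 1$ and $g(u) =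 f(u)$ for all $u \notin \{v, w\}$. The weak Roman domination number $\gamma_r(G)$ is the minimum of the weight $\sum_{v \in V} f(v)$ over all weak Roman dominating functions $f$ on $G$. **Theorem.** For every $n \ge 3$, $$\gamma_s(J_n) = \gamma_r(J_n) = \left\lceil \frac{3n+1}{2} \right\rceil .$$ -/

import Mathlib

namespace SimpleGraph

variable {V : Type*}

/-- `S` is a dominating set of `G`: every vertex outside `S` has a neighbour in `S`. -/
def IsDominatingSet (G : SimpleGraph V) (S : Finset V) : Prop :=
  ∀ v, v ∉ S → ∃ w ∈ S, G.Adj v w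

/-- `S` is a secure dominating set of `G`: it is a dominating set, and every vertex `v ∉ S` has a
neighbour `w ∈ S` such that `(S \ {w}) ∪ {v}` is again a dominating set. -/
def IsSecureDominatingSet [DecidableEq V] (G : SimpleGraph V) (S : Finset V) : Prop :=
  G.IsDominatingSet S ∧
    ∀ v, v ∉ S → ∃ w ∈ S, G.Adj v w ∧ G.IsDominatingSet ((S \ {w}) ∪ {v})

/-- The secure domination number `γ_s(G)` of a finite graph: the minimum size of a secure
dominating set. (The set of all vertices is one, so the infimum is attained.) -/
noncomputable def secureDominationNumber [Fintype V] [DecidableEq V] (G : SimpleGraph V) : ℕ :=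
  sInf {k | ∃ S : Finset V, G.IsSecureDominatingSet S ∧ S.card = k}

/-- The vertex `v` is undefended with respect to `f : V → {0, 1, 2}`: both `v` and all of its
neighbours have value `0`. -/
def IsUndefended (G : SimpleGraph V) (f : V → Fin 3) (v : V) : Prop :=
  f v = 0 ∧ ∀ w, G.Adj v w → f w = 0

/-- `f : V → {0, 1, 2}` is a weak Roman dominating function: every vertex `v` with `f v = 0` has a
neighbour `w` such that moving one unit from `w` to `v` gives a function `g : V → {0, 1, 2}` with
no undefended vertex. As `g w = f w - 1` is a value in `{0, 1, 2}`, this includes `f w ≥ 1`. -/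
def IsWeakRomanDominating (G : SimpleGraph V) (f : V → Fin 3) : Prop :=
  ∀ v, f v = 0 → ∃ w, G.Adj v w ∧
    ∃ g : V → Fin 3, g v = 1 ∧ (g w : ℕ) + 1 = (f w : ℕ) ∧ (∀ u, u ≠ v → u ≠ w → g u = f u) ∧
      ∀ u, ¬ G.IsUndefended g u

/-- The weak Roman domination number `γ_r(G)` of a finite graph: the minimum weight `∑ v, f v` of
a weak Roman dominating function. (The constant `1` is one, so the infimum is attained.) -/
noncomputable def weakRomanDominationNumber [Fintype V] (G : SimpleGraph V) : ℕ :=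
  sInf {k | ∃ f : V → Fin 3, G.IsWeakRomanDominating f ∧ ∑ v, (f v : ℕ) = k}

end SimpleGraph

/-- The names of the four vertices in each copy of `K_{1,3}`; `a` is the centre. -/
inductive FlowerLabel where
  | a | b | c | d
  deriving DecidableEq

instance : Fintype FlowerLabel where
  elems := {.a, .b, .c, .d}
  complete := by intro x; cases x <;> decide

/-- The edges of the flower snark `J_n`, each listed in one direction, with copies indexed by
`0, …, n - 1`: the three edges of each star, the `n`-cycle `b_0 … b_{n-1}`, and the `2n`-cycle
`c_0 … c_{n-1} d_0 … d_{n-1}`. -/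
def flowerSnarkRel (n : ℕ) : FlowerLabel × Fin n → FlowerLabel × Fin n → Prop
  | (.a, i), (.b, j) => i = j
  | (.a, i), (.c, j) => i = j
  | (.a, i), (.d, j) => i = j
  | (.b, i), (.b, j) => (i : ℕ) + 1 = j ∨ ((i : ℕ) + 1 = n ∧ (j : ℕ) = 0)
  | (.c, i), (.c, j) => (i : ℕ) + 1 = j
  | (.c, i), (.d, j) => (i : ℕ) + 1 = n ∧ (j : ℕ) = 0
  | (.d, i), (.d, j) => (i : ℕ) + 1 = j
  | (.d, i), (.c, j) => (i : ℕ) + 1 = n ∧ (j : ℕ) = 0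
  | _, _ => False

/-- The flower snark `J_n` (of interest for `n ≥ 3`). -/
def flowerSnark (n : ℕ) : SimpleGraph (FlowerLabel × Fin n) :=
  SimpleGraph.fromRel (flowerSnarkRel n)

/-! The flower snark is covered by an infinite ladder of stars: running through the `n` columns once
exchanges `c` and `d`. Defending a vertex involves only columns at distance at most 3, so a weak
Roman dominating function lifts to a ladder assignment with a local property, `Guarded`, that a
finite search can test.

Lower bound (`lt_two_mul_weight`): every column has weight at least 1, since it contains the closed
neighbourhood of its `a`. The search excludes the weight sequences 111, 1121 and 1211. If the
average weight were at most 3/2, then from some column on the weights would repeat 12 or 1122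
(`weights_pattern_of_sum_le`). The search also shows that the weight-1 columns are then periodic, in
a way incompatible with the exchange of `c` and `d` after `n` columns.

Upper bound: explicit words of columns, built from a block with weights 1, 1, 2, 2 and a short tail
that absorbs the twist, give secure dominating sets. Their indicators are weak Roman dominating, so
one value serves both numbers. -/

/-- The involution of the labels exchanging `c` and `d`. -/
def swapCD : FlowerLabel → FlowerLabel
  | .c => .d
  | .d => .c
  | l => l

theorem swapCD_involutive : Function.Involutive swapCD := by
  intro l; cases l <;> rfl

/-! ### The ladder and its local defence condition. -/

/-- The neighbours of a vertex in the infinite ladder of stars `K_{1,3}` that covers the flower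
snarks; meaningful away from column `0`. -/
def ladderNbrs : FlowerLabel × ℕ → List (FlowerLabel × ℕ)
  | (.a, k) => [(.b, k), (.c, k), (.d, k)]
  | (l, k) => [(.a, k), (l, k - 1), (l, k + 1)]

/-- The vertex `v` of the ladder has positive value, or it can be defended by a neighbour `w` that
does not leave a neighbour `u` of `w` undefended. If `s` is false, then the vertices `u` two
columns away from `v` are ignored. -/
def Guarded (s : Bool) (F : FlowerLabel × ℕ → ℕ) (v : FlowerLabel × ℕ) : Prop :=
  1 ≤ F v ∨ ∃ w ∈ ladderNbrs v, 2 ≤ F w ∨ (1 ≤ F w ∧ ∀ u ∈ ladderNbrs w,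
    u = v ∨ (s = false ∧ (u.2 = v.2 + 2 ∨ v.2 = u.2 + 2)) ∨ 1 ≤ F u ∨
      ∃ x ∈ ladderNbrs u, x ≠ w ∧ 1 ≤ F x)

/-- The Boolean version of `Guarded`. -/
def guardedBool (s : Bool) (F : FlowerLabel × ℕ → ℕ) (v : FlowerLabel × ℕ) : Bool :=
  Nat.ble 1 (F v) || (ladderNbrs v).any fun w => Nat.ble 2 (F w) || (Nat.ble 1 (F w) &&
    (ladderNbrs w).all fun u => (Nat.beq u.2 v.2 && u.1 == v.1) ||
      (!s && (Nat.beq u.2 (v.2 + 2) || Nat.beq v.2 (u.2 + 2))) || Nat.ble 1 (F u) ||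
        (ladderNbrs u).any fun x => !(Nat.beq x.2 w.2 && x.1 == w.1) && Nat.ble 1 (F x))

theorem guardedBool_eq_true (s : Bool) (F : FlowerLabel × ℕ → ℕ) (v : FlowerLabel × ℕ) :
    guardedBool s F v = true ↔ Guarded s F v := by
  simp only [guardedBool, Guarded, Bool.or_eq_true, Bool.and_eq_true, List.any_eq_true,
    List.all_eq_true, Nat.ble_eq, Nat.beq_eq, beq_iff_eq, Bool.not_eq_true', ne_eq, Prod.ext_iff,
    and_comm (a := (_ : ℕ) = _), or_assoc, ← Bool.not_eq_true]

instance (s : Bool) (F : FlowerLabel × ℕ → ℕ) (v : FlowerLabel × ℕ) : Decidable (Guarded s F v) :=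
  decidable_of_iff _ (guardedBool_eq_true s F v)

theorem Guarded.mono {s : Bool} {F G : FlowerLabel × ℕ → ℕ} {v : FlowerLabel × ℕ} (h : F ≤ G)
    (hF : Guarded s F v) : Guarded s G v := by
  have h1 : ∀ m x, m ≤ F x → m ≤ G x := fun m x hx => hx.trans (h x)
  rcases hF with hF | ⟨w, hw, hF | ⟨hF, hu⟩⟩
  · exact .inl (h1 _ _ hF)
  · exact .inr ⟨w, hw, .inl (h1 _ _ hF)⟩
  · refine .inr ⟨w, hw, .inr ⟨h1 _ _ hF, fun u hu' => ?_⟩⟩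
    rcases hu u hu' with e | e | e | ⟨x, hx, hxw, e⟩
    · exact .inl e
    · exact .inr (.inl e)
    · exact .inr (.inr (.inl (h1 _ _ e)))
    · exact .inr (.inr (.inr ⟨x, hx, hxw, h1 _ _ e⟩))

theorem ladderNbrs_col {v w : FlowerLabel × ℕ} (h : w ∈ ladderNbrs v) :
    v.2 ≤ w.2 + 1 ∧ w.2 ≤ v.2 + 1 := by
  obtain ⟨l, k⟩ := v
  cases l <;> simp [ladderNbrs] at h <;> rcases h with rfl | rfl | rfl <;> simp <;> omega

theorem ladderNbrs_shift (i : ℕ) {v : FlowerLabel × ℕ} (h : 1 ≤ v.2) :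
    ladderNbrs (v.1, v.2 + i) = (ladderNbrs v).map fun x => (x.1, x.2 + i) := by
  obtain ⟨l, k⟩ := v
  simp only at h
  have e1 : k + i - 1 = k - 1 + i := by omega
  have e2 : k + i + 1 = k + 1 + i := by omega
  cases l <;> simp [ladderNbrs, e1, e2]

/-- Guardedness of vertices away from the left end is invariant under translation. -/
theorem guarded_shift (s : Bool) (F : FlowerLabel × ℕ → ℕ) (i : ℕ) {v : FlowerLabel × ℕ}
    (hv : 3 ≤ v.2) :
    Guarded s (fun v => F (v.1, v.2 + i)) v ↔ Guarded s F (v.1, v.2 + i) := by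
  have inj : ∀ x y : FlowerLabel × ℕ, (x.1, x.2 + i) = (y.1, y.2 + i) ↔ x = y := fun x y => by
    simp [Prod.ext_iff]
  have ex : ∀ (L : List (FlowerLabel × ℕ)) (p : FlowerLabel × ℕ → Prop),
      (∃ x ∈ L.map fun x => (x.1, x.2 + i), p x) ↔ ∃ x ∈ L, p (x.1, x.2 + i) := fun L p => by
    simp only [List.mem_map, exists_exists_and_eq_and]
  unfold Guarded
  rw [ladderNbrs_shift i (by omega), ex]
  refine or_congr Iff.rfl (exists_congr fun w => and_congr_right fun hw =>
    or_congr Iff.rfl (and_congr Iff.rfl ?_))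
  have := ladderNbrs_col hw
  rw [ladderNbrs_shift i (by omega), List.forall_mem_map]
  refine forall_congr' fun u => forall_congr' fun hu => ?_
  have := ladderNbrs_col hu
  rw [ladderNbrs_shift i (by omega), ex, inj]
  simp only [ne_eq, inj]
  have : u.2 = v.2 + 2 ∨ v.2 = u.2 + 2 ↔ u.2 + i = v.2 + i + 2 ∨ v.2 + i = u.2 + i + 2 := by omega
  rw [this]

/-! ### Finite search over windows of columns. -/

/-- A column of values of the ladder. -/
abbrev Column := FlowerLabel → ℕ

/-- The column with the given values. -/
def mkColumn (x y z t : ℕ) : Column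
  | .a => x
  | .b => y
  | .c => z
  | .d => t

/-- The sum of the values of a column. -/
def Column.weight (c : Column) : ℕ := c .a + c .b + c .c + c .d

/-- The assignment whose columns are listed in `W`, with value `d` outside. -/
def listVal (d : ℕ) (W : List Column) (v : FlowerLabel × ℕ) : ℕ := W.getD v.2 (fun _ => d) v.1

/-- All columns of the given weight with values at most `2`. -/
def columnsOfWeight (m : ℕ) : List Column :=
  (List.range 3).flatMap fun x => (List.range 3).flatMap fun y => (List.range 3).flatMap fun z =>
    (List.range 3).filterMap fun t => if x + y + z + t = m then some (mkColumn x y z t) else none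

/-- The first four columns of `W` are guarded when the columns of `W` are surrounded by columns
with all values `2`. -/
def WindowGuarded (s : Bool) (W : List Column) : Prop :=
  ∀ k ∈ List.range (min 4 W.length), ∀ l ∈ [FlowerLabel.a, .b, .c, .d],
    Guarded s (listVal 2 ((fun _ => 2) :: (fun _ => 2) :: (fun _ => 2) :: W)) (l, k + 3)

instance (s : Bool) (W : List Column) : Decidable (WindowGuarded s W) := by
  unfold WindowGuarded; infer_instance

/-- The windows of guarded columns with the given weights. -/
def guardedWindows (s : Bool) : List ℕ → List (List Column)
  | [] => [[]]
  | m :: ω => (guardedWindows s ω).flatMap fun W =>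
      ((columnsOfWeight m).map fun c => c :: W).filter fun W => WindowGuarded s W

/-- The list of the `m` columns of `F` starting from column `i`. -/
def window (F : FlowerLabel × ℕ → ℕ) (i m : ℕ) : List Column :=
  (List.range m).map fun j l => F (l, i + j)

theorem mem_columnsOfWeight {c : Column} (hc : ∀ l, c l ≤ 2) : c ∈ columnsOfWeight c.weight := by
  have e : c = mkColumn (c .a) (c .b) (c .c) (c .d) := by funext l; cases l <;> rfl
  simp only [columnsOfWeight, List.mem_flatMap, List.mem_range, List.mem_filterMap]
  exact ⟨c .a, Nat.lt_succ_of_le (hc _), c .b, Nat.lt_succ_of_le (hc _), c .c,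
    Nat.lt_succ_of_le (hc _), c .d, Nat.lt_succ_of_le (hc _), (if_pos rfl).trans (congrArg some e.symm)⟩

/-- Guardedness is monotone in the values, so replacing everything outside the window by the maximal
value 2 preserves it. -/
theorem windowGuarded_window {s : Bool} {F : FlowerLabel × ℕ → ℕ} (hF : ∀ v, F v ≤ 2)
    (hG : ∀ v : FlowerLabel × ℕ, 3 ≤ v.2 → Guarded s F v) (i m : ℕ) :
    WindowGuarded s (window F (i + 3) m) := by
  intro k hk l _
  refine ((guarded_shift s F i (v := (l, k + 3)) (by simp)).2 (hG _ ?_)).mono ?_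
  · simp only; omega
  · rintro ⟨l, j⟩
    obtain h | rfl | rfl | ⟨j, rfl⟩ : j = 0 ∨ j = 1 ∨ j = 2 ∨ ∃ j', j = j' + 3 := by
      rcases j with _ | _ | _ | j <;> simp
    · subst h; exact hF _
    · exact hF _
    · exact hF _
    · simp only [listVal, window, List.getD_cons_succ]
      by_cases hj : j < m
      · rw [List.getD_eq_getElem _ _ (by simpa using hj)]
        simp [add_comm, add_left_comm]
      · rw [List.getD_eq_default _ _ (by simpa using hj)]
        exact hF _

/-- Soundness of the search, which grows windows leftwards. A new column can affect guardedness only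
in itself and the next three columns, so testing four columns at each step loses nothing. -/
theorem window_mem_guardedWindows {s : Bool} {F : FlowerLabel × ℕ → ℕ} (hF : ∀ v, F v ≤ 2)
    (hG : ∀ v : FlowerLabel × ℕ, 3 ≤ v.2 → Guarded s F v) (ω : List ℕ) {i : ℕ} (hi : 3 ≤ i)
    (h : ∀ j < ω.length, Column.weight (fun l => F (l, i + j)) = ω.getD j 0) :
    window F i ω.length ∈ guardedWindows s ω := by
  induction ω generalizing i with
  | nil => simp [guardedWindows, window]
  | cons m ω ih =>
    have e : window F i (ω.length + 1) = (fun l => F (l, i)) :: window F (i + 1) ω.length := by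
      simp [window, List.range_succ_eq_map, add_assoc, add_comm 1]
    simp only [guardedWindows, List.mem_flatMap, List.mem_filter, List.mem_map, decide_eq_true_eq]
    refine ⟨_, ih (i := i + 1) (by omega) fun j hj => ?_, ⟨_, ?_, e.symm⟩, ?_⟩
    · rw [add_assoc, add_comm 1 j, h (j + 1) (by simpa using hj), List.getD_cons_succ]
    · have h0 := h 0 (by simp)
      simp only [add_zero, List.getD_cons_zero] at h0
      rw [← h0]
      exact mem_columnsOfWeight fun l => hF _
    · obtain ⟨i, rfl⟩ := Nat.exists_eq_add_of_le' hi
      exact windowGuarded_window hF hG i _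

theorem guardedWindows_one_one_one :
    guardedWindows false [1, 1, 1] = [] := by decide +kernel

theorem guardedWindows_one_one_two_one :
    guardedWindows false [1, 1, 2, 1] = [] := by decide +kernel

theorem guardedWindows_one_two_one_one :
    guardedWindows false [1, 2, 1, 1] = [] := by decide +kernel

/-- The weight-1 columns have period 6. The three excluded relations are those that the twist would
force for `n` congruent to 0, 2 and 4 modulo 6. -/
theorem guardedWindows_one_two_alternating :
    ∀ W ∈ guardedWindows false [1, 2, 1, 2, 1, 2, 1],
      W.getD 6 0 = W.getD 0 0 ∧
      ¬ (W.getD 0 0 = W.getD 0 0 ∘ swapCD ∧ W.getD 2 0 = W.getD 2 0 ∘ swapCD ∧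
          W.getD 4 0 = W.getD 4 0 ∘ swapCD) ∧
      ¬ (W.getD 2 0 = W.getD 0 0 ∘ swapCD ∧ W.getD 4 0 = W.getD 2 0 ∘ swapCD) ∧
      ¬ (W.getD 4 0 = W.getD 0 0 ∘ swapCD ∧ W.getD 0 0 = W.getD 2 0 ∘ swapCD) := by
  decide +kernel

/-- The weight-1 columns have period 4, which divides `n` in this case, so the twist would make both
of them symmetric in `c` and `d`. -/
theorem guardedWindows_one_one_two_two :
    ∀ W ∈ guardedWindows true [1, 1, 2, 2, 1, 1, 2],
      W.getD 4 0 = W.getD 0 0 ∧ W.getD 5 0 = W.getD 1 0 ∧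
      ¬ (W.getD 0 0 = W.getD 0 0 ∘ swapCD ∧ W.getD 1 0 = W.getD 1 0 ∘ swapCD) := by
  decide +kernel

/-! ### The covering of the flower snark by the ladder. -/

theorem div_mod_succ {n : ℕ} (hn : 0 < n) (k : ℕ) :
    (k % n + 1 = n ∧ (k + 1) % n = 0 ∧ (k + 1) / n = k / n + 1) ∨
      (k % n + 1 < n ∧ (k + 1) % n = k % n + 1 ∧ (k + 1) / n = k / n) := by
  have h1 := Nat.mod_lt k hn
  have h2 := Nat.div_add_mod k n
  rcases (Nat.succ_le_of_lt h1).eq_or_lt with h | h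
  · have e : k + 1 = n * (k / n + 1) := by rw [mul_add]; omega
    refine .inl ⟨h, ?_, ?_⟩
    · rw [e]; exact Nat.mul_mod_right _ _
    · rw [e, Nat.mul_div_cancel_left _ hn]
  · have e : k + 1 = n * (k / n) + (k % n + 1) := by omega
    refine .inr ⟨h, ?_, ?_⟩
    · rw [e, Nat.mul_add_mod, Nat.mod_eq_of_lt h]
    · rw [e, Nat.mul_add_div hn, Nat.div_eq_of_lt h, add_zero]

/-- The covering map from the ladder to the flower snark: it exchanges `c` and `d` each time the
columns have been run through. -/
def ladderProj {n : ℕ} (hn : 0 < n) (v : FlowerLabel × ℕ) : FlowerLabel × Fin n :=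
  (swapCD^[v.2 / n] v.1, ⟨v.2 % n, Nat.mod_lt _ hn⟩)

theorem swapCD_iterate (q : ℕ) : swapCD^[q] = id ∨ swapCD^[q] = swapCD := by
  rcases Nat.even_or_odd q with h | h
  · exact .inl (swapCD_involutive.iterate_even h)
  · exact .inr (swapCD_involutive.iterate_odd h)

theorem ladderProj_injOn {n : ℕ} (hn : 0 < n) {x y : FlowerLabel × ℕ}
    (h : ladderProj hn x = ladderProj hn y) (hxy : x.2 < y.2 + n) (hyx : y.2 < x.2 + n) : x = y := by
  obtain ⟨l, i⟩ := x
  obtain ⟨m, j⟩ := y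
  simp only [ladderProj, Prod.mk.injEq, Fin.mk.injEq] at h hxy hyx
  obtain ⟨h1, h2⟩ := h
  have hij : i = j := by
    have h3 := Nat.div_add_mod i n
    have h4 := Nat.div_add_mod j n
    have : i / n = j / n := by
      rcases lt_trichotomy (i / n) (j / n) with h | h | h
      · have := Nat.mul_le_mul_left n (Nat.succ_le_of_lt h)
        rw [Nat.succ_eq_add_one, mul_add] at this; omega
      · exact h
      · have := Nat.mul_le_mul_left n (Nat.succ_le_of_lt h)
        rw [Nat.succ_eq_add_one, mul_add] at this; omega
    rw [← h3, ← h4, this, h2]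
  subst hij
  rw [(swapCD_involutive.injective.iterate _) h1]

theorem ladderProj_add_period {n : ℕ} (hn : 0 < n) (l : FlowerLabel) (k : ℕ) :
    ladderProj hn (l, k + n) = ladderProj hn (swapCD l, k) := by
  simp [ladderProj, Nat.add_div_right k hn]

theorem ladderProj_of_lt {n : ℕ} (hn : 0 < n) (l : FlowerLabel) {k : ℕ} (hk : k < n) :
    ladderProj hn (l, k) = (l, ⟨k, hk⟩) := by
  simp [ladderProj, Nat.div_eq_of_lt hk, Nat.mod_eq_of_lt hk]

/-- The projection is a local isomorphism; column 0 is left out because it has no left neighbour in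
the ladder. -/
theorem flowerSnark_adj_iff_ladderNbrs {n : ℕ} (hn : 3 ≤ n) {v : FlowerLabel × ℕ} (hv : 1 ≤ v.2)
    (y : FlowerLabel × Fin n) :
    (flowerSnark n).Adj (ladderProj (by omega) v) y ↔
      ∃ w ∈ ladderNbrs v, y = ladderProj (by omega) w := by
  obtain ⟨l, k⟩ := v
  obtain ⟨k, rfl⟩ := Nat.exists_eq_add_of_le' hv
  obtain ⟨m, j, hj⟩ := y
  have h1 := div_mod_succ (n := n) (by omega) k
  have h2 := div_mod_succ (n := n) (by omega) (k + 1)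
  have hq := swapCD_iterate (k / n)
  have e : (∃ w ∈ ladderNbrs (l, k + 1), ((m, ⟨j, hj⟩) : FlowerLabel × Fin n) =
      ladderProj (by omega) w) ↔ ∃ w ∈ ladderNbrs (l, k + 1), m = swapCD^[w.2 / n] w.1 ∧
        j = w.2 % n := by
    simp only [ladderProj, Prod.mk.injEq, Fin.mk.injEq]
  rw [e]
  simp only [ladderProj, flowerSnark, SimpleGraph.fromRel_adj, ne_eq, Prod.mk.injEq, Fin.mk.injEq]
  rcases h1 with ⟨ha, hb, hc⟩ | ⟨ha, hb, hc⟩ <;> rcases h2 with ⟨hd, he, hf⟩ | ⟨hd, he, hf⟩ <;>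
    simp only [hb, hc] at hd he hf <;>
    rcases hq with hq | hq <;> cases l <;> cases m <;>
    simp [ladderNbrs, flowerSnarkRel, hb, hc, he, hf, hq, swapCD,
      Function.iterate_succ_apply'] <;> omega

/-- The ladder is bipartite: the colour is the parity of the column, flipped at the vertices `a`. -/
theorem ladderNbrs_parity {v w : FlowerLabel × ℕ} (hv : 1 ≤ v.2) (h : w ∈ ladderNbrs v) :
    ((w.1 = .a ↔ v.1 = .a) ↔ w.2 % 2 ≠ v.2 % 2) := by
  obtain ⟨l, k⟩ := v
  simp only at hv
  cases l <;> simp [ladderNbrs] at h <;> rcases h with rfl | rfl | rfl <;> simp <;> omega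

/-- The new unit on `v` must not be what protects `u`. A protector `x` may lie 3 columns from `v`,
and for `n = 3` it can be another lift of `v`; hence `s = true` needs `4 ≤ n`, and `s = false`
ignores those `u`. -/
theorem guarded_of_isWeakRomanDominating {n : ℕ} (hn : 3 ≤ n)
    {f : FlowerLabel × Fin n → Fin 3} (hf : (flowerSnark n).IsWeakRomanDominating f) {s : Bool}
    (hs : s = true → 4 ≤ n) {v : FlowerLabel × ℕ} (hv : 3 ≤ v.2) :
    Guarded s (fun v => (f (ladderProj (by omega) v) : ℕ)) v := by
  have hn0 : 0 < n := by omega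
  by_cases h0 : 1 ≤ (f (ladderProj hn0 v) : ℕ)
  · exact .inl h0
  have h0' : f (ladderProj hn0 v) = 0 := Fin.ext (by simpa using h0)
  obtain ⟨w', hvw, g, hgv, hgw, hg, hdom⟩ := hf _ h0'
  rw [flowerSnark_adj_iff_ladderNbrs hn (by omega)] at hvw
  obtain ⟨w, hw, rfl⟩ := hvw
  refine .inr ⟨w, hw, ?_⟩
  by_cases h2 : 2 ≤ (f (ladderProj hn0 w) : ℕ)
  · exact .inl h2
  refine .inr ⟨(by omega : 1 ≤ (f (ladderProj hn0 w) : ℕ)), fun u hu => ?_⟩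
  have cw := ladderNbrs_col hw
  have cu := ladderNbrs_col hu
  by_cases huv : u = v
  · exact .inl huv
  by_cases hfar : s = false ∧ (u.2 = v.2 + 2 ∨ v.2 = u.2 + 2)
  · exact .inr (.inl hfar)
  refine .inr (.inr ?_)
  have gw0 : g (ladderProj hn0 w) = 0 := Fin.ext (by simp only [Fin.val_zero]; omega)
  have pos_of_g {x : FlowerLabel × ℕ} (hxv : ladderProj hn0 x ≠ ladderProj hn0 v)
      (hx : g (ladderProj hn0 x) ≠ 0) : 1 ≤ (f (ladderProj hn0 x) : ℕ) := by
    rw [← hg _ hxv fun h => hx (h ▸ gw0)]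
    exact Nat.one_le_iff_ne_zero.2 fun h => hx (Fin.ext h)
  have hu' := hdom (ladderProj hn0 u)
  simp only [SimpleGraph.IsUndefended, not_and_or, not_forall] at hu'
  rcases hu' with hu' | ⟨y, hy, hgy⟩
  · exact .inl (pos_of_g (fun h => huv (ladderProj_injOn hn0 h (by omega) (by omega))) hu')
  · rw [flowerSnark_adj_iff_ladderNbrs hn (by omega)] at hy
    obtain ⟨x, hx, rfl⟩ := hy
    have cx := ladderNbrs_col hx
    refine .inr ⟨x, hx, fun h => hgy (h ▸ gw0), pos_of_g (fun h => ?_) hgy⟩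
    have hxv : x = v := ladderProj_injOn hn0 h (by cases s <;> simp at hs hfar <;> omega)
      (by cases s <;> simp at hs hfar <;> omega)
    subst hxv
    -- Here `x`, `w`, `u` would form a triangle in a bipartite graph.
    have p1 := ladderNbrs_parity (by omega) hw
    have p2 := ladderNbrs_parity (by omega) hu
    have p3 := ladderNbrs_parity (by omega) hx
    by_cases a1 : x.1 = .a <;> by_cases a2 : w.1 = .a <;> by_cases a3 : u.1 = .a <;>
      simp only [a1, a2, a3, true_iff, false_iff, not_true_eq_false] at p1 p2 p3 <;>
      omega

/-- A set is a secure dominating set of the flower snark if all lifts of its vertices to the ladder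
are guarded. -/
theorem isSecureDominatingSet_of_guarded {n : ℕ} (hn : 3 ≤ n) {S : Finset (FlowerLabel × Fin n)}
    (h : ∀ v : FlowerLabel × ℕ, 3 ≤ v.2 → v.2 < n + 3 →
      Guarded true (fun v => if ladderProj (by omega) v ∈ S then 1 else 0) v) :
    (flowerSnark n).IsSecureDominatingSet S := by
  have hn0 : 0 < n := by omega
  have lift (y : FlowerLabel × Fin n) :
      ∃ v : FlowerLabel × ℕ, 3 ≤ v.2 ∧ v.2 < n + 3 ∧ ladderProj hn0 v = y := by
    obtain ⟨m, j, hj⟩ := y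
    by_cases h3 : 3 ≤ j
    · exact ⟨(m, j), h3, by simp only; omega, ladderProj_of_lt hn0 m hj⟩
    · refine ⟨(swapCD m, j + n), by simp only; omega, by simp only; omega, ?_⟩
      rw [ladderProj_add_period, swapCD_involutive m, ladderProj_of_lt hn0 m hj]
  have key (y) (hy : y ∉ S) : ∃ v : FlowerLabel × ℕ, 3 ≤ v.2 ∧ v.2 < n + 3 ∧
      ladderProj hn0 v = y ∧ ∃ w ∈ ladderNbrs v, ladderProj hn0 w ∈ S ∧ ∀ u ∈ ladderNbrs w,
        u = v ∨ ladderProj hn0 u ∈ S ∨ ∃ x ∈ ladderNbrs u, x ≠ w ∧ ladderProj hn0 x ∈ S := by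
    obtain ⟨v, hv, hv', rfl⟩ := lift y
    have one_le (x : FlowerLabel × ℕ) : 1 ≤ (if ladderProj hn0 x ∈ S then 1 else 0) ↔
        ladderProj hn0 x ∈ S := by split_ifs with hx <;> simp [hx]
    refine ⟨v, hv, hv', rfl, ?_⟩
    rcases h v hv hv' with h1 | ⟨w, hw, h2 | ⟨h1, hu⟩⟩
    · exact absurd ((one_le _).1 h1) hy
    · simp only at h2; split_ifs at h2 <;> omega
    · refine ⟨w, hw, (one_le _).1 h1, fun u hu' => ?_⟩
      simpa [one_le] using hu u hu'
  have dom : (flowerSnark n).IsDominatingSet S := by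
    intro y hy
    obtain ⟨v, hv, -, rfl, w, hw, hwS, -⟩ := key y hy
    exact ⟨_, hwS, (flowerSnark_adj_iff_ladderNbrs hn (by omega) _).2 ⟨w, hw, rfl⟩⟩
  refine ⟨dom, fun y hy => ?_⟩
  obtain ⟨v, hv, -, rfl, w, hw, hwS, hu⟩ := key y hy
  have hvw := (flowerSnark_adj_iff_ladderNbrs hn (v := v) (by omega) _).2 ⟨w, hw, rfl⟩
  refine ⟨_, hwS, hvw, fun z hz => ?_⟩
  have cw := ladderNbrs_col hw
  simp only [Finset.mem_union, Finset.mem_sdiff, Finset.mem_singleton, not_or, not_and, not_not]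
    at hz ⊢
  by_cases hzw : z = ladderProj hn0 w
  · exact ⟨_, .inr rfl, hzw ▸ hvw.symm⟩
  have hzS : z ∉ S := fun h => hzw (hz.1 h)
  -- Only neighbours of the vertex being left can lose their dominator.
  by_cases hwz : (flowerSnark n).Adj (ladderProj hn0 w) z
  · obtain ⟨u, hu', rfl⟩ := (flowerSnark_adj_iff_ladderNbrs hn (by omega) _).1 hwz
    have cu := ladderNbrs_col hu'
    rcases hu u hu' with rfl | h1 | ⟨x, hx, hxw, hxS⟩
    · exact absurd rfl hz.2
    · exact absurd h1 hzS
    · have cx := ladderNbrs_col hx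
      exact ⟨_, .inl ⟨hxS, fun e => hxw (ladderProj_injOn hn0 e (by omega) (by omega))⟩,
        (flowerSnark_adj_iff_ladderNbrs hn (by omega) _).2 ⟨x, hx, rfl⟩⟩
  · obtain ⟨x, hxS, hx⟩ := dom z hzS
    exact ⟨x, .inl ⟨hxS, fun e => hwz (e ▸ hx.symm)⟩, hx⟩

/-! ### The lower bound. -/

/-- Start where the partial sums of `2 * w - 3` are maximal. They cannot rise above this level, so
the excluded patterns force 12 or 1122, each returning to the maximum. After 12, the block 1122
would create 1211. -/
theorem weights_pattern_of_sum_le {n : ℕ} (hn : 0 < n) {w : ℕ → ℕ} (hper : ∀ k, w (k + n) = w k)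
    (hpos : ∀ k, 1 ≤ w k) (hsum : 2 * ∑ k ∈ Finset.range n, w k ≤ 3 * n)
    (h111 : ∀ k, 3 ≤ k → ¬ (w k = 1 ∧ w (k + 1) = 1 ∧ w (k + 2) = 1))
    (h1121 : ∀ k, 3 ≤ k → ¬ (w k = 1 ∧ w (k + 1) = 1 ∧ w (k + 2) = 2 ∧ w (k + 3) = 1))
    (h1211 : ∀ k, 3 ≤ k → ¬ (w k = 1 ∧ w (k + 1) = 2 ∧ w (k + 2) = 1 ∧ w (k + 3) = 1)) :
    (∃ k, 3 ≤ k ∧ ∀ j, w (k + 2 * j) = 1 ∧ w (k + 2 * j + 1) = 2) ∨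
      ∃ k, 3 ≤ k ∧ ∀ j, w (k + 4 * j) = 1 ∧ w (k + 4 * j + 1) = 1 ∧ w (k + 4 * j + 2) = 2 ∧
        w (k + 4 * j + 3) = 2 := by
  let S : ℕ → ℤ := fun k => ∑ i ∈ Finset.range k, (2 * (w i : ℤ) - 3)
  have S_succ (k) : S (k + 1) = S k + (2 * (w k : ℤ) - 3) := Finset.sum_range_succ _ _
  have S_n : S n ≤ 0 := by
    have : S n = 2 * ((∑ k ∈ Finset.range n, w k : ℕ) : ℤ) - 3 * n := by
      simp [S, Finset.sum_sub_distrib, Finset.mul_sum, mul_comm]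
    omega
  have S_add (k) : S (k + n) ≤ S k := by
    induction k with
    | zero => simpa [S] using S_n
    | succ k ih =>
      rw [add_right_comm, S_succ, S_succ, hper]
      omega
  obtain ⟨k0, hk0, hmax⟩ := Finset.exists_max_image (Finset.Ico 3 (n + 3)) S
    ⟨3, Finset.mem_Ico.2 ⟨le_rfl, by omega⟩⟩
  rw [Finset.mem_Ico] at hk0
  have hle (k) (hk : 3 ≤ k) : S k ≤ S k0 := by
    induction k using Nat.strong_induction_on with
    | _ k ih =>
      by_cases hkn : k < n + 3
      · exact hmax k (Finset.mem_Ico.2 ⟨hk, hkn⟩)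
      · obtain ⟨j, rfl⟩ := Nat.exists_eq_add_of_le' (show n ≤ k by omega)
        exact (S_add j).trans (ih j (by omega) (by omega))
  have block (k) (hk : 3 ≤ k) (hS : S k = S k0) :
      (w k = 1 ∧ w (k + 1) = 2 ∧ S (k + 2) = S k0) ∨
      (w k = 1 ∧ w (k + 1) = 1 ∧ w (k + 2) = 2 ∧ w (k + 3) = 2 ∧ S (k + 4) = S k0) := by
    have a1 := S_succ k
    have a2 := S_succ (k + 1)
    have a3 := S_succ (k + 2)
    have a4 := S_succ (k + 3)
    have b1 := hle (k + 1) (by omega)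
    have b2 := hle (k + 2) (by omega)
    have b3 := hle (k + 3) (by omega)
    have b4 := hle (k + 4) (by omega)
    have c1 := hpos k
    have c2 := hpos (k + 1)
    have c3 := hpos (k + 2)
    have c4 := hpos (k + 3)
    have d1 := h111 k hk
    have d2 := h1121 k hk
    simp only [add_assoc, Nat.reduceAdd] at a2 a3 a4
    omega
  by_cases h12 : ∃ k, 3 ≤ k ∧ S k = S k0 ∧ w k = 1 ∧ w (k + 1) = 2
  · obtain ⟨k, hk, hS, h1, h2⟩ := h12
    refine .inl ⟨k, hk, fun j => ?_⟩
    suffices S (k + 2 * j) = S k0 ∧ w (k + 2 * j) = 1 ∧ w (k + 2 * j + 1) = 2 from this.2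
    induction j with
    | zero => exact ⟨hS, h1, h2⟩
    | succ j ih =>
      obtain ⟨e0, e1, e2⟩ := ih
      have e3 : S (k + 2 * j + 2) = S k0 := by
        rcases block _ (by omega) e0 with h | h <;> omega
      have := h1211 (k + 2 * j) (by omega)
      rcases block _ (by omega) e3 with h | h
      · exact ⟨e3, h.1, h.2.1⟩
      · exact absurd ⟨e1, e2, h.1, h.2.1⟩ this
  · refine .inr ⟨k0, hk0.1, fun j => ?_⟩
    have block' (k) (hk : 3 ≤ k) (hS : S k = S k0) := (block k hk hS).resolve_left
      fun h => h12 ⟨k, hk, hS, h.1, h.2.1⟩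
    have hS : S (k0 + 4 * j) = S k0 := by
      induction j with
      | zero => rfl
      | succ j ih => exact (block' _ (by omega) ih).2.2.2.2
    have := block' _ (by omega) hS
    exact ⟨this.1, this.2.1, this.2.2.1, this.2.2.2.1⟩

theorem sum_flowerLabel (f : FlowerLabel → ℕ) : ∑ l, f l = Column.weight f := by
  change ∑ l ∈ ({.a, .b, .c, .d} : Finset FlowerLabel), f l = _
  simp [Column.weight, add_assoc]

theorem sum_eq_sum_weight {n : ℕ} (hn : 0 < n) (f : FlowerLabel × Fin n → ℕ) :
    ∑ v, f v = ∑ k ∈ Finset.range n, Column.weight fun l => f (ladderProj hn (l, k)) := by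
  rw [Fintype.sum_prod_type_right, Finset.sum_range]
  refine Finset.sum_congr rfl fun i _ => ?_
  rw [sum_flowerLabel]
  congr 1
  funext l
  rw [ladderProj_of_lt hn l i.2]

theorem lt_two_mul_weight {n : ℕ} (hn : 3 ≤ n) {f : FlowerLabel × Fin n → Fin 3}
    (hf : (flowerSnark n).IsWeakRomanDominating f) : 3 * n < 2 * ∑ v, (f v : ℕ) := by
  have hn0 : 0 < n := by omega
  by_contra! hsum
  set F : FlowerLabel × ℕ → ℕ := fun v => (f (ladderProj hn0 v) : ℕ) with hFdef
  have hF2 (v) : F v ≤ 2 := Nat.le_of_lt_succ (f _).2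
  have hG {s : Bool} (hs : s = true → 4 ≤ n) (v : FlowerLabel × ℕ) (hv : 3 ≤ v.2) :
      Guarded s F v := guarded_of_isWeakRomanDominating hn hf hs hv
  have hG' := hG (s := false) (by simp)
  set w : ℕ → ℕ := fun k => Column.weight fun l => F (l, k) with hw
  have hFper (l k) : F (l, k + n) = F (swapCD l, k) := by
    simp only [hFdef, ladderProj_add_period]
  have hper (k) : w (k + n) = w k := by
    simp only [hw, hFper, Column.weight, swapCD]
    omega
  have hpos3 (k) (hk : 3 ≤ k) : 1 ≤ w k := by
    have := hG' (.a, k) hk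
    simp only [Guarded, ladderNbrs, List.mem_cons, List.not_mem_nil, or_false] at this
    simp only [hw, Column.weight]
    rcases this with h | ⟨x, rfl | rfl | rfl, h | ⟨h, -⟩⟩ <;> omega
  have hpos (k) : 1 ≤ w k := by
    rw [← hper]
    exact hpos3 _ (by omega)
  have mem {s : Bool} (hs : s = true → 4 ≤ n) {i : ℕ} (hi : 3 ≤ i) (ω : List ℕ)
      (h : ∀ j < ω.length, w (i + j) = ω.getD j 0) : window F i ω.length ∈ guardedWindows s ω :=
    window_mem_guardedWindows hF2 (hG hs) ω hi h
  have mem' := @mem false (by simp)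
  have getD_window (i m j) (hj : j < m) : (window F i m).getD j 0 = fun l => F (l, i + j) := by
    rw [List.getD_eq_getElem _ _ (by simpa [window] using hj)]
    simp [window]
  have hpat := weights_pattern_of_sum_le hn0 hper hpos
    (by rwa [sum_eq_sum_weight hn0] at hsum)
    (fun k hk h => by
      have := mem' hk [1, 1, 1] fun j hj => by
        simp only [List.length_cons, List.length_nil] at hj
        interval_cases j <;> simp [h]
      rw [guardedWindows_one_one_one] at this
      simp at this)
    (fun k hk h => by
      have := mem' hk [1, 1, 2, 1] fun j hj => by
        simp only [List.length_cons, List.length_nil] at hj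
        interval_cases j <;> simp [h]
      rw [guardedWindows_one_one_two_one] at this
      simp at this)
    (fun k hk h => by
      have := mem' hk [1, 2, 1, 1] fun j hj => by
        simp only [List.length_cons, List.length_nil] at hj
        interval_cases j <;> simp [h]
      rw [guardedWindows_one_two_one_one] at this
      simp at this)
  have hcol (k) : (fun l => F (l, k + n)) = (fun l => F (l, k)) ∘ swapCD :=
    funext fun l => hFper l k
  rcases hpat with ⟨k, hk, hp⟩ | ⟨k, hk, hp⟩
  · have main (j) := guardedWindows_one_two_alternating _ (mem' (i := k + 2 * j) (by omega)
      [1, 2, 1, 2, 1, 2, 1] fun i hi => by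
        simp only [List.length_cons, List.length_nil] at hi
        have h0 := hp j
        have h1 := hp (j + 1)
        have h2 := hp (j + 2)
        have h3 := hp (j + 3)
        interval_cases i
        exacts [h0.1, h0.2, h1.1, h1.2, h2.1, h2.2, h3.1])
    simp only [getD_window, List.length_cons, List.length_nil, Nat.reduceAdd, Nat.reduceLT, add_zero] at main
    -- The weight-1 columns depend only on their index modulo 3; `shift` then compares this period
    -- with the twist, `n` being `2 * m`.
    have step (q r : ℕ) : (fun l => F (l, k + 2 * (3 * q + r))) = fun l => F (l, k + 2 * r) := by
      induction q with
      | zero => simp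
      | succ q ih =>
        rw [← ih]
        refine Eq.trans ?_ (main (3 * q + r)).1
        congr! 3; omega
    obtain ⟨m, hm⟩ : ∃ m, n = 2 * m := by
      rcases Nat.even_or_odd' n with ⟨m, h | h⟩
      · exact ⟨m, h⟩
      · have := hper (k)
        rw [h, show k + (2 * m + 1) = k + 2 * m + 1 by omega, (hp m).2] at this
        have := (hp 0).1
        simp at this; omega
    have shift (r) : (fun l => F (l, k + 2 * (m % 3 + r))) = (fun l => F (l, k + 2 * r)) ∘ swapCD := by
      rw [← step (m / 3), ← hcol]
      congr! 3; omega
    have m0 := (main 0).2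
    have s0 := shift 0
    have s1 := shift 1
    have s2 := shift 2
    have e3 := step 1 0
    simp only [mul_zero, add_zero, mul_one, Nat.reduceMul] at m0 s0 s1 s2 e3
    obtain h | h | h : m % 3 = 0 ∨ m % 3 = 1 ∨ m % 3 = 2 := by omega
    all_goals simp only [h, mul_zero, add_zero, zero_add, mul_one, Nat.reduceMul, Nat.reduceAdd] at s0 s1 s2
    · exact m0.1 ⟨s0, s1, s2⟩
    · exact m0.2.1 ⟨s0, s1⟩
    · exact m0.2.2 ⟨s0, e3 ▸ s1⟩
  · have hmod : 4 ∣ n := by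
      have h0 := hper k
      have h1 := hper (k + 1)
      have p0 := hp 0
      have p := hp (n / 4)
      have p' := hp (n / 4 + 1)
      simp only [mul_zero, add_zero] at p0
      obtain h | h | h | h : n % 4 = 0 ∨ n % 4 = 1 ∨ n % 4 = 2 ∨ n % 4 = 3 := by omega
      · omega
      · rw [show k + 1 + n = k + 4 * (n / 4) + 2 by omega] at h1; omega
      · rw [show k + n = k + 4 * (n / 4) + 2 by omega] at h0; omega
      · rw [show k + n = k + 4 * (n / 4) + 3 by omega] at h0; omega
    -- `s = true` is allowed because `4 ∣ n` gives `4 ≤ n`.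
    have main (j) := guardedWindows_one_one_two_two _ (mem (s := true) (fun _ => by omega)
      (i := k + 4 * j) (by omega)
      [1, 1, 2, 2, 1, 1, 2] fun i hi => by
        simp only [List.length_cons, List.length_nil] at hi
        have h0 := hp j
        have h1 := hp (j + 1)
        interval_cases i
        exacts [h0.1, h0.2.1, h0.2.2.1, h0.2.2.2, h1.1, h1.2.1, h1.2.2.1])
    simp only [getD_window, List.length_cons, List.length_nil, Nat.reduceAdd, Nat.reduceLT, add_zero] at main
    have step (q : ℕ) : (fun l => F (l, k + 4 * q)) = (fun l => F (l, k)) ∧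
        (fun l => F (l, k + 1 + 4 * q)) = fun l => F (l, k + 1) := by
      induction q with
      | zero => simp
      | succ q ih =>
        rw [← ih.1, ← ih.2]
        constructor
        · refine Eq.trans ?_ ((main q).1.trans ?_) <;> congr! 3
        · refine Eq.trans ?_ ((main q).2.1.trans ?_) <;> congr! 3 <;> omega
    obtain ⟨m, rfl⟩ := hmod
    refine (main 0).2.2 ?_
    simp only [mul_zero, add_zero]
    exact ⟨(step m).1.symm.trans (hcol k), (step m).2.symm.trans (hcol (k + 1))⟩

/-! ### The upper bound by explicit words. -/

/-- `W` lists the first `n + 6` columns of the lift to the ladder of the indicator function of a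
secure dominating set of the flower snark with `n` columns and `m` elements. -/
structure SecureWord (n m : ℕ) (W : List Column) : Prop where
  length_eq : W.length = n + 6
  twist : ∀ j < 6, W.getD (n + j) 0 = W.getD j 0 ∘ swapCD
  le_one : ∀ j < n, ∀ l, W.getD j 0 l ≤ 1
  guarded : ∀ k < n, ∀ l, Guarded true (listVal 0 ((W.drop k).take 7)) (l, 3)
  weight : ((List.range n).map fun k => Column.weight (W.getD k 0)).sum = m

instance (n m : ℕ) (W : List Column) : Decidable (SecureWord n m W) :=
  decidable_of_iff (W.length = n + 6 ∧ (∀ j < 6, W.getD (n + j) 0 = W.getD j 0 ∘ swapCD) ∧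
    (∀ j < n, ∀ l, W.getD j 0 l ≤ 1) ∧
    (∀ k < n, ∀ l, Guarded true (listVal 0 ((W.drop k).take 7)) (l, 3)) ∧
    ((List.range n).map fun k => Column.weight (W.getD k 0)).sum = m)
    ⟨fun ⟨h1, h2, h3, h4, h5⟩ => ⟨h1, h2, h3, h4, h5⟩,
      fun ⟨h1, h2, h3, h4, h5⟩ => ⟨h1, h2, h3, h4, h5⟩⟩

theorem SecureWord.exists_isSecureDominatingSet {n m : ℕ} {W : List Column} (hn : 3 ≤ n)
    (h : SecureWord n m W) :
    ∃ S : Finset (FlowerLabel × Fin n), (flowerSnark n).IsSecureDominatingSet S ∧ S.card = m := by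
  have hn0 : 0 < n := by omega
  let S : Finset (FlowerLabel × Fin n) := Finset.univ.filter fun v => W.getD v.2 0 v.1 = 1
  have ind (v : FlowerLabel × Fin n) : (if v ∈ S then 1 else 0) = W.getD v.2 0 v.1 := by
    have := h.le_one v.2 v.2.2 v.1
    simp only [S, Finset.mem_filter, Finset.mem_univ, true_and]
    split_ifs <;> omega
  have lift (k : ℕ) : ∀ (l : FlowerLabel), k < n + 6 →
      (if ladderProj hn0 (l, k) ∈ S then 1 else 0) = W.getD k 0 l := by
    induction k using Nat.strong_induction_on with
    | _ k ih =>
      intro l hk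
      by_cases hkn : k < n
      · rw [ladderProj_of_lt hn0 l hkn, ind]
      · obtain ⟨j, rfl⟩ := Nat.exists_eq_add_of_le (Nat.le_of_not_lt hkn)
        have e : ladderProj hn0 (l, n + j) = ladderProj hn0 (swapCD l, j) := by
          rw [add_comm, ladderProj_add_period]
        rw [e, ih j (by omega) _ (by omega), h.twist j (by omega)]
        rfl
  refine ⟨S, isSecureDominatingSet_of_guarded hn ?_, ?_⟩
  · rintro ⟨l, k⟩ hk hk'
    obtain ⟨k, rfl⟩ := Nat.exists_eq_add_of_le' hk
    simp only at hk'
    have := (guarded_shift true (fun v => if ladderProj hn0 v ∈ S then 1 else 0) k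
      (v := (l, 3)) le_rfl).1 ((h.guarded k (by omega) l).mono ?_)
    · simpa only [add_comm] using this
    · rintro ⟨l, j⟩
      simp only [listVal]
      by_cases hj : j < 7
      · rw [add_comm j k, lift (k + j) l (by omega)]
        simp only [List.getD_eq_getElem?_getD, List.getElem?_take, if_pos hj, List.getElem?_drop]
        exact le_rfl
      · rw [List.getD_eq_default _ _ (by simp; omega)]
        exact Nat.zero_le _
  · have e : S.card = ∑ v, if v ∈ S then 1 else 0 := by simp
    rw [e, sum_eq_sum_weight hn0, ← h.weight]
    change _ = ∑ k ∈ Finset.range n, Column.weight (W.getD k 0)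
    refine Finset.sum_congr rfl fun k hk => congrArg _ (funext fun l => lift k l ?_)
    have := Finset.mem_range.1 hk
    omega

/-- The four columns that repeat in secure dominating sets of flower snarks. -/
def secureBlock : List Column :=
  [mkColumn 0 0 0 1, mkColumn 0 0 1 0, mkColumn 0 1 0 1, mkColumn 0 1 1 0]

/-- Two leading blocks cover the first six columns, so prepending a third leaves the twist condition
intact, and every new window of seven columns lies within three blocks. -/
theorem SecureWord.block_append {n m : ℕ} {X : List Column}
    (h : SecureWord n m (secureBlock ++ (secureBlock ++ X))) :
    SecureWord (n + 4) (m + 6) (secureBlock ++ (secureBlock ++ (secureBlock ++ X))) := by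
  set W := secureBlock ++ (secureBlock ++ X) with hW
  have hlen : secureBlock.length = 4 := rfl
  have getD_add (k) : (secureBlock ++ W).getD (k + 4) 0 = W.getD k 0 := rfl
  have getD_lt (j) (hj : j < 6) : (secureBlock ++ W).getD j 0 = W.getD j 0 := by
    interval_cases j <;> rfl
  constructor
  · have := h.length_eq
    rw [List.length_append, this, hlen]; omega
  · intro j hj
    rw [add_right_comm, getD_add, getD_lt j hj, h.twist j hj]
  · intro j hj l
    rcases Nat.lt_or_ge j 4 with h4 | h4
    · have key : ∀ j < 4, ∀ l, secureBlock.getD j 0 l ≤ 1 := by decide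
      have := key j h4 l
      interval_cases j <;> exact this
    · obtain ⟨j, rfl⟩ := Nat.exists_eq_add_of_le' h4
      exact h.le_one j (by omega) l
  · intro k hk
    rcases Nat.lt_or_ge k 4 with h4 | h4
    · have key : ∀ k < 4, ∀ l, Guarded true (listVal 0
          (((secureBlock ++ (secureBlock ++ secureBlock)).drop k).take 7)) (l, 3) := by
        decide +kernel
      intro l
      have := key k h4 l
      interval_cases k <;> exact this
    · obtain ⟨k, rfl⟩ := Nat.exists_eq_add_of_le' h4
      exact h.guarded k (by omega)
  · rw [add_comm n 4, List.range_add, List.map_append, List.sum_append, List.map_map]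
    have e : (fun k => Column.weight ((secureBlock ++ W).getD k 0)) ∘ (4 + ·) =
        fun k => Column.weight (W.getD k 0) := by
      funext k
      simp only [Function.comp, add_comm 4 k, getD_add]
    rw [e, h.weight, add_comm m 6]
    rfl

/-- The word of length `n + 6` that continues the word `w` of length `n` with `c` and `d`
exchanged each time it has been run through. -/
def twistedExtension (w : List Column) : List Column :=
  (w ++ w.map (· ∘ swapCD) ++ w).take (w.length + 6)

theorem exists_secureWord_of_lt_nine {n : ℕ} (hn : 3 ≤ n) (hn' : n < 9) :
    ∃ W, SecureWord n ((3 * n + 2) / 2) W := by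
  have h3 : SecureWord 3 5 (twistedExtension
    [mkColumn 0 0 0 1, mkColumn 0 1 1 0, mkColumn 0 1 0 1]) := by decide +kernel
  have h4 : SecureWord 4 7 (twistedExtension
    [mkColumn 0 0 0 1, mkColumn 0 0 1 0, mkColumn 0 1 0 1, mkColumn 0 1 1 1]) := by decide +kernel
  have h5 : SecureWord 5 8 (twistedExtension (secureBlock ++ [mkColumn 0 1 0 1])) := by
    decide +kernel
  have h6 : SecureWord 6 10 (twistedExtension
    (secureBlock ++ [mkColumn 0 0 0 1, mkColumn 0 1 1 1])) := by decide +kernel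
  have h7 : SecureWord 7 11 (twistedExtension (secureBlock ++
    [mkColumn 0 0 0 1, mkColumn 0 1 1 0, mkColumn 0 1 0 1])) := by decide +kernel
  have h8 : SecureWord 8 13 (twistedExtension (secureBlock ++
    [mkColumn 0 0 0 1, mkColumn 0 0 1 0, mkColumn 0 1 0 1, mkColumn 0 1 1 1])) := by decide +kernel
  interval_cases n
  exacts [⟨_, h3⟩, ⟨_, h4⟩, ⟨_, h5⟩, ⟨_, h6⟩, ⟨_, h7⟩, ⟨_, h8⟩]

theorem exists_secureWord_of_nine_le {n : ℕ} (hn : 9 ≤ n) :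
    ∃ X, SecureWord n ((3 * n + 2) / 2) (secureBlock ++ (secureBlock ++ X)) := by
  induction n using Nat.strong_induction_on with
  | _ n ih =>
    by_cases h13 : 13 ≤ n
    · obtain ⟨n, rfl⟩ := Nat.exists_eq_add_of_le' (show 4 ≤ n by omega)
      obtain ⟨X, hX⟩ := ih n (by omega) (by omega)
      refine ⟨secureBlock ++ X, ?_⟩
      rw [show (3 * (n + 4) + 2) / 2 = (3 * n + 2) / 2 + 6 by omega]
      exact hX.block_append
    -- The six columns after position `n` are the first six with `c` and `d` exchanged.
    let six : List Column := ((secureBlock ++ secureBlock).map (· ∘ swapCD)).take 6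
    have h9 : SecureWord 9 14 (secureBlock ++ (secureBlock ++ ([mkColumn 0 1 0 1] ++ six))) := by
      decide +kernel
    have h10 : SecureWord 10 16 (secureBlock ++ (secureBlock ++
      ([mkColumn 0 0 0 1, mkColumn 0 1 1 1] ++ six))) := by decide +kernel
    have h11 : SecureWord 11 17 (secureBlock ++ (secureBlock ++
      ([mkColumn 0 0 0 1, mkColumn 0 1 1 0, mkColumn 0 1 0 1] ++ six))) := by decide +kernel
    have h12 : SecureWord 12 19 (secureBlock ++ (secureBlock ++
      ([mkColumn 0 0 0 1, mkColumn 0 0 1 0, mkColumn 0 1 0 1, mkColumn 0 1 1 1] ++ six))) := by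
      decide +kernel
    have : n < 13 := by omega
    interval_cases n
    exacts [⟨_, h9⟩, ⟨_, h10⟩, ⟨_, h11⟩, ⟨_, h12⟩]

theorem exists_isSecureDominatingSet_flowerSnark {n : ℕ} (hn : 3 ≤ n) :
    ∃ S : Finset (FlowerLabel × Fin n), (flowerSnark n).IsSecureDominatingSet S ∧
      S.card = (3 * n + 2) / 2 := by
  rcases Nat.lt_or_ge n 9 with h | h
  · obtain ⟨W, hW⟩ := exists_secureWord_of_lt_nine hn h
    exact hW.exists_isSecureDominatingSet hn
  · obtain ⟨X, hX⟩ := exists_secureWord_of_nine_le h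
    exact hX.exists_isSecureDominatingSet hn

/-! ### From secure domination to weak Roman domination, and the conclusion. -/

namespace SimpleGraph

variable {V : Type*} [DecidableEq V]

theorem IsSecureDominatingSet.isWeakRomanDominating {G : SimpleGraph V} {S : Finset V}
    (h : G.IsSecureDominatingSet S) :
    G.IsWeakRomanDominating fun v => if v ∈ S then 1 else 0 := by
  intro v hv
  have hvS : v ∉ S := fun hS => by simp [hS] at hv
  obtain ⟨w, hw, hvw, hd⟩ := h.2 v hvS
  have hne : v ≠ w := fun e => hvS (e ▸ hw)
  refine ⟨w, hvw, fun u => if u ∈ (S \ {w}) ∪ {v} then 1 else 0, by simp, by simp [hw, hne.symm],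
    fun u hu hu' => by simp [hu, hu'], fun u hu => ?_⟩
  have hu0 : u ∉ (S \ {w}) ∪ {v} := fun hS => by
    have := hu.1
    simp only [if_pos hS] at this
    exact absurd this (by decide)
  obtain ⟨x, hx, hux⟩ := hd u hu0
  have := hu.2 x hux
  simp only [if_pos hx] at this
  exact absurd this (by decide)

theorem sum_indicator_eq_card [Fintype V] (S : Finset V) :
    ∑ v, ((if v ∈ S then (1 : Fin 3) else 0 : Fin 3) : ℕ) = S.card := by
  simp [apply_ite (fun x : Fin 3 => (x : ℕ))]

end SimpleGraph

theorem mainTheorem1 (n : ℕ) (hn : 3 ≤ n) :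
    (flowerSnark n).secureDominationNumber = (flowerSnark n).weakRomanDominationNumber ∧
      (flowerSnark n).weakRomanDominationNumber = ⌈((3 * n + 1 : ℚ) / 2)⌉₊ := by
  -- `(3 * n + 2) / 2` is the least integer exceeding `3 * n / 2`, hence the form of the strict
  -- lower bound.
  have hceil : ⌈((3 * n + 1 : ℚ) / 2)⌉₊ = (3 * n + 2) / 2 := by
    refine (Nat.ceil_eq_iff (by omega)).2 ?_
    rcases Nat.even_or_odd' (3 * n) with ⟨m, h | h⟩
    · have hq : (3 * n : ℚ) = 2 * m := by exact_mod_cast h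
      rw [show (3 * n + 2) / 2 = m + 1 by omega, hq]
      push_cast
      constructor <;> linarith
    · have hq : (3 * n : ℚ) = 2 * m + 1 := by exact_mod_cast h
      rw [show (3 * n + 2) / 2 = m + 1 by omega, hq]
      push_cast
      constructor <;> linarith
  have hlow {k : ℕ} (hk : ∃ f : FlowerLabel × Fin n → Fin 3,
      (flowerSnark n).IsWeakRomanDominating f ∧ ∑ v, (f v : ℕ) = k) : (3 * n + 2) / 2 ≤ k := by
    obtain ⟨f, hf, rfl⟩ := hk
    have := lt_two_mul_weight hn hf
    omega
  have hind (S : Finset (FlowerLabel × Fin n)) (hS : (flowerSnark n).IsSecureDominatingSet S) :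
      ∃ f : FlowerLabel × Fin n → Fin 3,
        (flowerSnark n).IsWeakRomanDominating f ∧ ∑ v, (f v : ℕ) = S.card :=
    ⟨_, hS.isWeakRomanDominating, SimpleGraph.sum_indicator_eq_card S⟩
  obtain ⟨S, hS, hcard⟩ := exists_isSecureDominatingSet_flowerSnark hn
  have hr : (flowerSnark n).weakRomanDominationNumber = (3 * n + 2) / 2 :=
    le_antisymm (Nat.sInf_le (hcard ▸ hind S hS))
      (le_csInf ⟨_, hind S hS⟩ fun k hk => hlow hk)
  have hs : (flowerSnark n).secureDominationNumber = (3 * n + 2) / 2 :=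
    le_antisymm (Nat.sInf_le ⟨S, hS, hcard⟩)
      (le_csInf ⟨_, S, hS, rfl⟩ fun k ⟨T, hT, hk⟩ => hk ▸ hlow (hind T hT))
  exact ⟨hs.trans hr.symm, hr.trans hceil.symm⟩
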